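/- Let $D$ be an oriented knot diagram with $n\ge 1$ crossings and let $\pi$ be the group of the knot that it represents, with its Wirtinger presentation: one meridian generator $m_r$ for each of the $n$ arcs $r$ of $D$ (an arc runs from one undercrossing to the next) and, for each crossing with over strand $i$, incoming under strand $j$, outgoing under strand $k$ and sign $\sigma=\pm1$, the relation $m_jm_i^{\sigma}=m_i^{\sigma}m_k$. The variety of augmentations $A(D)\subset\mathbb C^{\binom n2}$ is the set of points $\varepsilon=(\varepsilon_{rs})$, indexed by unordered pairs of distinct arcs, such that, with $\varepsilon_{rr}=2$ and $\varepsilon_{sr}=\varepsilon_{rs}$, one has $\varepsilon_{lj}+\varepsilon_{lk}=\varepsilon_{li}\varepsilon_{ij}$ for all arcs $l$ and all crossings with over strand $i$ and under strands $j,k$. The rank of $\varepsilon$ is the rank of the matrix $[\varepsilon_{rs}]$. Put $\varepsilon(r,s,t)=\varepsilon_{rs}^2+\varepsilon_{rt}^2+\varepsilon_{st}^2-\varepsilon_{rs}\varepsilon_{rt}\varepsilon_{st}-2$. An $\varepsilon\in A(D)$ of rank three is called elliptic if $\varepsilon_{rs}\in[-2,2]\subset\mathbb R$ for all distinct arcs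 $r,s$ and $\varepsilon(r,s,t)\in[-2,2]$ for all distinct arcs $r,s,t$. Let $\varepsilon\in A(D)$ have rank three. Then there are arcs $a_1,a_2,a_3$ with $T:=\det[\varepsilon_{a_ia_j}]_{1\le i,j\le3}\neq0$. For every choice of such arcs and of a square root $\sigma$ of $T/2$ there is exactly one character $\chi=\mathfrak X(\varepsilon)$ of a trace-free representation $\pi\to\mathrm{SL}_2(\mathbb C)$ (one that sends meridians to matrices of trace $0$) such that $\chi(m_rm_s^{-1})=\varepsilon_{rs}$ for all $r\ne s$ and $-\chi(m_{a_1}m_{a_2}m_{a_3})=\sigma$. This $\mathfrak X(\varepsilon)$ is not the character of a representation into the binary-dihedral subgroup $S^1\cup S^1\mathbf j$ of $\mathrm{SU}(2)$, and $$\varepsilon\text{ is elliptic}\iff\mathfrak X(\varepsilon)\text{ is the character of a representation }\pi\to\mathrm{SU}(2).$$ Moreover, suppose that $\varepsilon$ is elliptic. Then there are arcs $p,q,r$ with $\varepsilon_{pq}\in(-2,2)$ and $\varepsilon(p,q,r)<2$. For all such arcs and each root $d$ of $d^2-\varepsilon_{pq}d+1=0$ put $a_l=\frac{\varepsilon_{ql}-\varepsilon_{pl}d}{\varepsilon_{pq}-2d}$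 for every arc $l$, $a=a_r$ and $\alpha=1-a(\varepsilon_{pr}-a)$. Then there are matrices of determinant one $$A_l=\begin{pmatrix}a_l&b_l\\c_l&\varepsilon_{pl}-a_l\end{pmatrix},\qquad c_l=a(\varepsilon_{pl}-a_l)-\varepsilon_{rl}+b_l-b_la(\varepsilon_{pr}-a)+(\varepsilon_{pr}-a)a_l,$$ and a square root $\beta$ of $\alpha$ such that, with $$T_\beta=\begin{pmatrix}0&\sqrt{-1}\,\beta^{-1}\\\sqrt{-1}\,\beta&0\end{pmatrix},\qquad P=\begin{pmatrix}\beta^{-1}&\beta^{-1}\\1&-1\end{pmatrix},$$ the assignment $m_l\mapsto P^{-1}(T_\beta A_l)P$ defines a representation $\pi\to\mathrm{SU}(2)$ with character $\mathfrak X(\varepsilon)$. -/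

import Mathlib

noncomputable section

/-- A signed Gauss code with `n` crossings. A passage `(c, true)` (resp. `(c, false)`) is the moment
at which one traverses the crossing `c` along its over (resp. under) strand. `next` sends a passage
to the following one along the orientation, and `sign c` is the sign of the crossing `c`. -/
structure GaussCode where
  n : ℕ
  next : Equiv.Perm (Fin n × Bool)
  sign : Fin n → ℤˣ

namespace GaussCode

/-- The state `(p, δ)` means: leaving passage `p` in direction `δ` (`1` along the orientation, `-1`
against it). Follow the edge to the passage at its other end and turn left there onto the other
strand. At a positive crossing the under strand crosses the over strand from right to left, at
a negative crossing from left to right. -/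
def faceStep (G : GaussCode) (x : (Fin G.n × Bool) × ℤˣ) : (Fin G.n × Bool) × ℤˣ :=
  let q := (G.next ^ (x.2 : ℤ)) x.1
  ((q.1, !q.2), x.2 * (if q.2 then 1 else -1) * G.sign q.1)

/-- The faces of the surface carrying the diagram: the orbits of `faceStep`. -/
def Face (G : GaussCode) : Type :=
  Quot fun x y : (Fin G.n × Bool) × ℤˣ => y = G.faceStep x

end GaussCode

/-- An oriented knot diagram on the sphere with at least one crossing: a signed Gauss code with
one component (all passages form a single cycle) and of genus zero
(Euler characteristic `n - 2n + #faces = 2`, which forces `n ≠ 0`). -/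
structure KnotDiagram extends GaussCode where
  one_component : next.IsCycleOn Set.univ
  planar : Nat.card toGaussCode.Face = n + 2

namespace KnotDiagram

/-- The components (arcs) of the diagram, from an undercrossing to the next one. The class of
a passage `p` is the arc containing the edge that leaves `p`; the edges before and after an
overpass lie on the same arc. -/
def Arc (D : KnotDiagram) : Type :=
  Quot fun p q : Fin D.n × Bool => q = D.next p ∧ q.2 = true

instance (D : KnotDiagram) : Finite D.Arc :=
  inferInstanceAs (Finite (Quot fun p q : Fin D.n × Bool => q = D.next p ∧ q.2 = true))

instance (D : KnotDiagram) : Fintype D.Arc := Fintype.ofFinite _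

/-- The overcrossing strand at a crossing. -/
def overArc (D : KnotDiagram) (c : Fin D.n) : D.Arc := Quot.mk _ (c, true)

/-- The undercrossing strand that arrives at a crossing. -/
def underIn (D : KnotDiagram) (c : Fin D.n) : D.Arc := Quot.mk _ (D.next.symm (c, false))

/-- The undercrossing strand that leaves a crossing. -/
def underOut (D : KnotDiagram) (c : Fin D.n) : D.Arc := Quot.mk _ (c, false)

/-! ### The knot group, its trace-free characters and its `SU(2)` characters -/

/-- The Wirtinger relators `m_j m_i^σ m_k⁻¹ m_i^{-σ}`, one for each crossing of sign `σ`, with over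
strand `i`, incoming under strand `j` and outgoing under strand `k`. -/
def wirtingerRels (D : KnotDiagram) : Set (FreeGroup D.Arc) :=
  Set.range fun c : Fin D.n =>
    FreeGroup.of (D.underIn c) * FreeGroup.of (D.overArc c) ^ (D.sign c : ℤ) *
      (FreeGroup.of (D.underOut c))⁻¹ * FreeGroup.of (D.overArc c) ^ (-(D.sign c : ℤ))

/-- The knot group, through the Wirtinger presentation. -/
abbrev KnotGroup (D : KnotDiagram) : Type := PresentedGroup D.wirtingerRels

/-- The meridian of an arc. -/
def meridian (D : KnotDiagram) (r : D.Arc) : D.KnotGroup := PresentedGroup.of r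

/-- The set of characters of trace-free representations of the knot group in `SL₂(ℂ)`. -/
def traceFreeCharacters (D : KnotDiagram) : Set (D.KnotGroup → ℂ) :=
  {χ | ∃ ρ : D.KnotGroup →* Matrix.SpecialLinearGroup (Fin 2) ℂ,
    (∀ r, Matrix.trace (ρ (D.meridian r) : Matrix (Fin 2) (Fin 2) ℂ) = 0) ∧
    ∀ g, χ g = Matrix.trace (ρ g : Matrix (Fin 2) (Fin 2) ℂ)}

/-- `χ` is the character of the representation `ρ` in `SU(2)`. -/
def IsCharacterOf (D : KnotDiagram) (χ : D.KnotGroup → ℂ)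
    (ρ : D.KnotGroup →* Matrix.specialUnitaryGroup (Fin 2) ℂ) : Prop :=
  ∀ g, χ g = Matrix.trace (ρ g : Matrix (Fin 2) (Fin 2) ℂ)

/-- `χ` is the character of a representation in `SU(2)`. -/
def IsSU2Character (D : KnotDiagram) (χ : D.KnotGroup → ℂ) : Prop :=
  ∃ ρ : D.KnotGroup →* Matrix.specialUnitaryGroup (Fin 2) ℂ, D.IsCharacterOf χ ρ

/-- `χ` is the character of a representation with image in the binary-dihedral subgroup
`S¹ ∪ S¹ j` of `SU(2)`, that is, by diagonal and anti-diagonal matrices. -/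
def IsBinaryDihedralCharacter (D : KnotDiagram) (χ : D.KnotGroup → ℂ) : Prop :=
  ∃ ρ : D.KnotGroup →* Matrix.specialUnitaryGroup (Fin 2) ℂ, D.IsCharacterOf χ ρ ∧
    ∀ g, ((ρ g : Matrix (Fin 2) (Fin 2) ℂ) 0 1 = 0 ∧ (ρ g : Matrix (Fin 2) (Fin 2) ℂ) 1 0 = 0) ∨
      ((ρ g : Matrix (Fin 2) (Fin 2) ℂ) 0 0 = 0 ∧ (ρ g : Matrix (Fin 2) (Fin 2) ℂ) 1 1 = 0)

/-! ### The variety of augmentations -/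

/-- Points of `ℂ^(n choose 2)`: one coordinate for each unordered pair of distinct arcs. -/
abbrev PairCoords (D : KnotDiagram) : Type := {e : Sym2 D.Arc // ¬ e.IsDiag} → ℂ

open Classical in
/-- The symmetric matrix `[ε_rs]`, with `ε_rr = 2`. -/
def cordMatrix (D : KnotDiagram) (ε : D.PairCoords) : Matrix D.Arc D.Arc ℂ :=
  Matrix.of fun r s => if h : s(r, s).IsDiag then 2 else ε ⟨s(r, s), h⟩

/-- The variety of augmentations `A(D)`. -/
def augVariety (D : KnotDiagram) : Set D.PairCoords :=
  {ε | ∀ (c : Fin D.n) (l : D.Arc),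
    D.cordMatrix ε l (D.underIn c) + D.cordMatrix ε l (D.underOut c)
      - D.cordMatrix ε l (D.overArc c) * D.cordMatrix ε (D.overArc c) (D.underIn c) = 0}

/-- The rank of an augmentation. -/
def augRank (D : KnotDiagram) (ε : D.PairCoords) : ℕ := (D.cordMatrix ε).rank

/-- `ε(r,s,t) = ε_rs² + ε_rt² + ε_st² - ε_rs ε_rt ε_st - 2`. -/
def triple (D : KnotDiagram) (ε : D.PairCoords) (r s t : D.Arc) : ℂ :=
  D.cordMatrix ε r s ^ 2 + D.cordMatrix ε r t ^ 2 + D.cordMatrix ε s t ^ 2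
    - D.cordMatrix ε r s * D.cordMatrix ε r t * D.cordMatrix ε s t - 2

/-- The bounds that define an elliptic augmentation (among those of rank three). -/
def IsElliptic (D : KnotDiagram) (ε : D.PairCoords) : Prop :=
  (∀ r s : D.Arc, r ≠ s → D.cordMatrix ε r s ∈ Complex.ofReal '' Set.Icc (-2) 2) ∧
  (∀ r s t : D.Arc, r ≠ s → r ≠ t → s ≠ t →
    D.triple ε r s t ∈ Complex.ofReal '' Set.Icc (-2) 2)

/-- The principal minor `T(a,a) = det [ε_{a_i a_j}]` of size three. -/
def minor (D : KnotDiagram) (ε : D.PairCoords) (a : Fin 3 → D.Arc) : ℂ :=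
  ((D.cordMatrix ε).submatrix a a).det

/-- `χ` is the trace-free character `𝔛(ε)` for the choice of a triple of arcs `a` and of a square
root `σ` of `T(a,a)/2`: its coordinates `x_rs = tr ρ(m_r m_s⁻¹)` are `ε_rs`, and its coordinate
`x_{a₁a₂a₃} = -tr ρ(m_{a₁} m_{a₂} m_{a₃})` is `σ`. -/
def IsFrakX (D : KnotDiagram) (ε : D.PairCoords) (a : Fin 3 → D.Arc) (σ : ℂ)
    (χ : D.KnotGroup → ℂ) : Prop :=
  χ ∈ D.traceFreeCharacters ∧
  (∀ r s : D.Arc, r ≠ s → χ (D.meridian r * (D.meridian s)⁻¹) = D.cordMatrix ε r s) ∧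
  -χ (D.meridian (a 0) * D.meridian (a 1) * D.meridian (a 2)) = σ

/-! ### The explicit matrices, for arcs `p, q, r` in the roles of `1, 2, 3` -/

/-- `ε_pq ∈ (-2,2)` and `ε(p,q,r) < 2`. -/
def IsGoodTriple (D : KnotDiagram) (ε : D.PairCoords) (p q r : D.Arc) : Prop :=
  D.cordMatrix ε p q ∈ Complex.ofReal '' Set.Ioo (-2) 2 ∧
  D.triple ε p q r ∈ Complex.ofReal '' Set.Iio 2

/-- `a_l = (ε_ql - ε_pl d) / (ε_pq - 2 d)`. -/
def aEntry (D : KnotDiagram) (ε : D.PairCoords) (p q : D.Arc) (d : ℂ) (l : D.Arc) : ℂ :=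
  (D.cordMatrix ε q l - D.cordMatrix ε p l * d) / (D.cordMatrix ε p q - 2 * d)

/-- `α = 1 - a (ε_pr - a)` with `a = a_r`. -/
def alpha (D : KnotDiagram) (ε : D.PairCoords) (p q r : D.Arc) (d : ℂ) : ℂ :=
  1 - D.aEntry ε p q d r * (D.cordMatrix ε p r - D.aEntry ε p q d r)

/-- The matrices `A_l` with rows `(a_l, b_l)` and `(c_l, ε_pl - a_l)`, where
`c_l = a (ε_pl - a_l) - ε_rl + b_l - b_l a (ε_pr - a) + (ε_pr - a) a_l` and `b_l` is such that
the determinant is `1`. -/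
def IsTraceFamily (D : KnotDiagram) (ε : D.PairCoords) (p q r : D.Arc) (d : ℂ)
    (A : D.Arc → Matrix (Fin 2) (Fin 2) ℂ) : Prop :=
  ∀ l, A l 0 0 = D.aEntry ε p q d l ∧
    A l 1 1 = D.cordMatrix ε p l - D.aEntry ε p q d l ∧
    A l 1 0 = D.aEntry ε p q d r * (D.cordMatrix ε p l - D.aEntry ε p q d l)
      - D.cordMatrix ε r l + A l 0 1
      - A l 0 1 * D.aEntry ε p q d r * (D.cordMatrix ε p r - D.aEntry ε p q d r)
      + (D.cordMatrix ε p r - D.aEntry ε p q d r) * D.aEntry ε p q d l ∧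
    (A l).det = 1

end KnotDiagram

/-- The trace-free matrix `T`, in terms of a square root `β` of `α`. -/
def matrixT (β : ℂ) : Matrix (Fin 2) (Fin 2) ℂ :=
  !![0, Complex.I * β⁻¹; Complex.I * β, 0]

/-- The matrix `P` whose columns are the eigenvectors `(β⁻¹, 1)` and `(β⁻¹, -1)` of `T`. -/
def matrixP (β : ℂ) : Matrix (Fin 2) (Fin 2) ℂ :=
  !![β⁻¹, β⁻¹; 1, -1]

end

/-!
Trace-free two by two matrices form a three-dimensional quadratic space with the determinant as
its form, and `-tr (X Y)` is twice the inner product of `X` and `Y`. Since `[ε_rs]` is symmetric of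
rank three, `[ε_rs] / 2` is the Gram matrix of unit vectors of this space, one for each arc. The
vectors of three arcs with `T ≠ 0` form a basis, so the equations of `A(D)` say that the half turn
about the over strand exchanges the vectors of the two under strands. Conjugation by a trace-free
matrix of determinant one is such a half turn, so these are the Wirtinger relations. The Gram
matrix together with the orientation `σ` determines the vectors up to a rotation, and rotations act
on matrices by multiplicative maps that preserve the trace, so the character is unique.

In a representation by diagonal and antidiagonal matrices each vector lies on a fixed axis or in the
plane orthogonal to it. Half turns about such vectors preserve the square of the coordinate along
the axis, which is therefore the same for all arcs of the knot, and the vectors cannot span.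

A trace-free matrix lies in `SU(2)` when its vector is real and of length one. Real vectors give the
elliptic inequalities, since `2 - ε(r,s,t)` is four times a squared volume. Conversely, orthonormal
coordinates adapted to the vectors of `p`, `q`, `r` are real when `ε` is elliptic, and the
trace-free matrices with these coordinates are the matrices `P⁻¹ (T A_l) P`.
-/

noncomputable section

open Matrix

section SymmetricMatrices

variable {m n ι K : Type*} {k : ℕ}

theorem exists_eq_mul_submatrix_of_mem_span [Semiring K] {M : Matrix m n K} {a : Fin k → m}
    (ha : ∀ l, M l ∈ Submodule.span K (Set.range fun i => M (a i))) :
    ∃ C : Matrix m (Fin k) K, M = C * M.submatrix a id := by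
  choose C hC using fun l => (Submodule.mem_span_range_iff_exists_fun K).1 (ha l)
  refine ⟨of C, ?_⟩
  ext l j
  simp [← hC l, mul_apply]

variable [Field K]

theorem mem_span_rows_of_rank_le [Finite m] [Fintype n] {M : Matrix m n K} (hM : M.rank ≤ k)
    {a : Fin k → m} (ha : LinearIndependent K fun i => M (a i)) (l : m) :
    M l ∈ Submodule.span K (Set.range fun i => M (a i)) := by
  have hspan : Submodule.span K (Set.range fun i => M (a i)) =
      Submodule.span K (Set.range M.row) := by
    refine Submodule.eq_of_le_of_finrank_le
      (Submodule.span_mono (Set.range_comp_subset_range a M)) ?_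
    rwa [← rank_eq_finrank_span_row, finrank_span_eq_card ha, Fintype.card_fin]
  exact hspan ▸ Submodule.subset_span ⟨l, rfl⟩

theorem linearIndependent_rows_of_det_submatrix_ne_zero {M : Matrix m n K} {a : Fin k → m}
    {b : Fin k → n} (h : (M.submatrix a b).det ≠ 0) : LinearIndependent K fun i => M (a i) :=
  .of_comp (LinearMap.funLeft K K b) <|
    linearIndependent_rows_iff_isUnit.2 ((isUnit_iff_isUnit_det _).2 h.isUnit)

theorem eq_mul_inv_submatrix_mul [Finite m] [Fintype n] {M : Matrix m n K} (hM : M.rank ≤ k)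
    {a : Fin k → m} {b : Fin k → n} (h : (M.submatrix a b).det ≠ 0) :
    M = M.submatrix id b * (M.submatrix a b)⁻¹ * M.submatrix a id := by
  obtain ⟨C, hC⟩ := exists_eq_mul_submatrix_of_mem_span
    (mem_span_rows_of_rank_le hM (linearIndependent_rows_of_det_submatrix_ne_zero h))
  have hcols : M.submatrix id b = C * M.submatrix a b := congrArg (·.submatrix id b) hC
  rw [hcols, mul_nonsing_inv_cancel_right _ _ h.isUnit, ← hC]

theorem eq_of_submatrix_eq [Fintype ι] {M N : Matrix ι ι K} (hM : M.IsSymm) (hN : N.IsSymm)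
    (hMk : M.rank ≤ k) (hNk : N.rank ≤ k) {a : Fin k → ι} (ha : (M.submatrix a a).det ≠ 0)
    (h : M.submatrix id a = N.submatrix id a) : M = N := by
  have hrows : M.submatrix a id = N.submatrix a id := by
    simpa only [transpose_submatrix, hM.eq, hN.eq] using congrArg transpose h
  have hminor : M.submatrix a a = N.submatrix a a := congrArg (·.submatrix a id) h
  rw [eq_mul_inv_submatrix_mul hMk ha, h, hrows, hminor,
    ← eq_mul_inv_submatrix_mul hNk (hminor ▸ ha)]

theorem exists_linearIndependent_rows_of_rank_eq [Finite m] [Fintype n] {M : Matrix m n K}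
    (hk : M.rank = k) : ∃ a : Fin k → m, LinearIndependent K fun i => M (a i) := by
  subst hk
  rw [rank_eq_finrank_span_row]
  obtain ⟨f, hf, -, hindep⟩ := Submodule.exists_fun_fin_finrank_span_eq K (Set.range M.row)
  choose a ha using hf
  exact ⟨a, (funext ha : (fun i => M (a i)) = f) ▸ hindep⟩

theorem exists_det_submatrix_ne_zero_of_isSymm [Fintype ι] {M : Matrix ι ι K} (hM : M.IsSymm)
    (hk : M.rank = k) : ∃ a : Fin k → ι, (M.submatrix a a).det ≠ 0 := by
  obtain ⟨a, ha⟩ := exists_linearIndependent_rows_of_rank_eq hk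
  obtain ⟨C, hC⟩ := exists_eq_mul_submatrix_of_mem_span (mem_span_rows_of_rank_le hk.le ha)
  have hcols : M.submatrix id a = C * M.submatrix a a := congrArg (·.submatrix id a) hC
  have hrows : M.submatrix a id = M.submatrix a a * Cᵀ := by
    simpa only [transpose_mul, transpose_submatrix, hM.eq] using congrArg transpose hcols
  have hle : k ≤ (M.submatrix a a).rank :=
    calc k = (C * (M.submatrix a a * Cᵀ)).rank := by rw [← hrows, ← hC, hk]
      _ ≤ (M.submatrix a a).rank := (rank_mul_le_right _ _).trans (rank_mul_le_left _ _)
  have hindep : LinearIndependent K (M.submatrix a a).row := by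
    rwa [linearIndependent_iff_card_le_finrank_span, Set.finrank, ← rank_eq_finrank_span_row,
      Fintype.card_fin]
  exact ⟨a, ((isUnit_iff_isUnit_det _).1 (linearIndependent_rows_iff_isUnit.1 hindep)).ne_zero⟩

theorem exists_eq_mul_diagonal_mul_transpose [NeZero (2 : K)] [Fintype ι] [DecidableEq ι]
    {N : Matrix ι ι K} (hN : N.IsSymm) :
    ∃ (W : Matrix ι ι K) (d : ι → K), N = W * diagonal d * Wᵀ := by
  have : Invertible (2 : K) := invertibleOfNonzero two_ne_zero
  let B := N.toBilin'
  obtain ⟨v, hv⟩ := LinearMap.BilinForm.exists_orthogonal_basis (B := B)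
    (LinearMap.BilinForm.isSymm_iff.1 (isSymm_toBilin'_iff_isSymm.2 hN))
  let w := v.reindex
    (Fintype.equivFinOfCardEq (Module.finrank_fintype_fun_eq_card K (η := ι)).symm).symm
  let e := Pi.basisFun K ι
  have hdiag : LinearMap.BilinForm.toMatrix w B = diagonal fun i => B (w i) (w i) := by
    ext i j
    rw [LinearMap.BilinForm.toMatrix_apply, diagonal_apply]
    split_ifs with hij
    · rw [hij]
    · simpa [w] using hv (by simpa using hij)
  refine ⟨(w.toMatrix e)ᵀ, fun i => B (w i) (w i), ?_⟩
  rw [← hdiag, transpose_transpose, LinearMap.BilinForm.toMatrix_mul_basis_toMatrix,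
    LinearMap.BilinForm.toMatrix_basisFun, LinearMap.BilinForm.toMatrix'_toBilin']

theorem exists_eq_mul_transpose_of_isSymm [IsAlgClosed K] [NeZero (2 : K)] [Fintype ι]
    {N : Matrix ι ι K} (hN : N.IsSymm) : ∃ V : Matrix ι ι K, N = V * Vᵀ := by
  classical
  obtain ⟨W, d, rfl⟩ := exists_eq_mul_diagonal_mul_transpose hN
  choose s hs using fun i => IsAlgClosed.exists_eq_mul_self (d i)
  refine ⟨W * diagonal s, ?_⟩
  simp only [transpose_mul, diagonal_transpose, Matrix.mul_assoc]
  rw [← Matrix.mul_assoc (diagonal s), diagonal_mul_diagonal, ← funext hs]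

theorem exists_eq_mul_transpose_of_rank_eq [IsAlgClosed K] [NeZero (2 : K)] [Fintype ι]
    {M : Matrix ι ι K} (hM : M.IsSymm) (hk : M.rank = k) :
    ∃ U : Matrix ι (Fin k) K, M = U * Uᵀ := by
  obtain ⟨a, ha⟩ := exists_det_submatrix_ne_zero_of_isSymm hM hk
  obtain ⟨V, hV⟩ := exists_eq_mul_transpose_of_isSymm (hM.submatrix a).inv
  have hcols : (M.submatrix id a)ᵀ = M.submatrix a id := by rw [transpose_submatrix, hM.eq]
  refine ⟨M.submatrix id a * V, ?_⟩
  rw [transpose_mul, hcols, Matrix.mul_assoc, ← Matrix.mul_assoc V, ← hV, ← Matrix.mul_assoc]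
  exact eq_mul_inv_submatrix_mul hk.le ha

theorem exists_rotation_of_mul_transpose_eq {R : Type*} [CommRing R] {U U' : Matrix ι (Fin k) R}
    (hUU' : U * Uᵀ = U' * U'ᵀ) {a : Fin k → ι} (ha : IsUnit (U.submatrix a id).det)
    (hdet : (U.submatrix a id).det = (U'.submatrix a id).det) :
    ∃ Q : Matrix (Fin k) (Fin k) R, Q * Qᵀ = 1 ∧ Q.det = 1 ∧ U * Q = U' := by
  set V := U.submatrix a id
  set V' := U'.submatrix a id
  have hVt : IsUnit Vᵀ.det := by rwa [det_transpose]
  have hVt' : IsUnit V'ᵀ.det := by rwa [det_transpose, ← hdet]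
  have hV' : IsUnit V'.det := hdet ▸ ha
  have hQ : U * (Vᵀ * V'ᵀ⁻¹) = U' := by
    have hcols : U * Vᵀ = U' * V'ᵀ := congrArg (·.submatrix id a) hUU'
    rw [← Matrix.mul_assoc, hcols, mul_nonsing_inv_cancel_right _ _ hVt']
  have hgram : V * Vᵀ = V' * V'ᵀ := congrArg (·.submatrix a a) hUU'
  refine ⟨Vᵀ * V'ᵀ⁻¹, ?_, ?_, hQ⟩
  · calc Vᵀ * V'ᵀ⁻¹ * (Vᵀ * V'ᵀ⁻¹)ᵀ = Vᵀ * (V' * V'ᵀ)⁻¹ * V := by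
          rw [transpose_mul, transpose_nonsing_inv, transpose_transpose, transpose_transpose,
            Matrix.mul_inv_rev]
          simp only [Matrix.mul_assoc]
      _ = Vᵀ * Vᵀ⁻¹ * (V⁻¹ * V) := by
          rw [← hgram, Matrix.mul_inv_rev]
          simp only [Matrix.mul_assoc]
      _ = 1 := by rw [mul_nonsing_inv _ hVt, nonsing_inv_mul _ ha, one_mul]
  · rw [det_mul, det_nonsing_inv, det_transpose, det_transpose, hdet, Ring.mul_inverse_cancel _ hV']

end SymmetricMatrices

section CrossProduct

variable {n R : Type*} [CommRing R]

theorem dotProduct_vecMul_vecMul_of_mul_transpose_eq_one [Fintype n] [DecidableEq n]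
    {Q : Matrix n n R} (hQ : Q * Qᵀ = 1) (u v : n → R) : (u ᵥ* Q) ⬝ᵥ (v ᵥ* Q) = u ⬝ᵥ v := by
  rw [← mulVec_transpose Q v, dotProduct_mulVec, vecMul_vecMul, hQ, vecMul_one]

theorem crossProduct_vecMul_vecMul_transpose (M : Matrix (Fin 3) (Fin 3) R) (u v : Fin 3 → R) :
    crossProduct (u ᵥ* M) (v ᵥ* M) ᵥ* Mᵀ = M.det • crossProduct u v := by
  ext i
  fin_cases i <;>
  · simp only [vecMul, dotProduct, Fin.sum_univ_three, cross_apply, det_fin_three, transpose_apply,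
      Pi.smul_apply, smul_eq_mul, cons_val, Fin.zero_eta, Fin.mk_one, Fin.reduceFinMk]
    ring

theorem crossProduct_vecMul_of_mul_transpose_eq_one {Q : Matrix (Fin 3) (Fin 3) R}
    (hQ : Q * Qᵀ = 1) (hdet : Q.det = 1) (u v : Fin 3 → R) :
    crossProduct (u ᵥ* Q) (v ᵥ* Q) = crossProduct u v ᵥ* Q := by
  have h := congrArg (· ᵥ* Q) (crossProduct_vecMul_vecMul_transpose Q u v)
  simpa only [vecMul_vecMul, mul_eq_one_comm.1 hQ, vecMul_one, hdet, one_smul] using h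

end CrossProduct

section TraceFreeMatrices

/-- The trace-free matrix with coordinates `u` in the basis `Complex.I • σ` of Pauli matrices, in
which the determinant is the sum of the squares of the coordinates and the real vectors are the
purely imaginary quaternions. -/
def traceFreeMatrix : (Fin 3 → ℂ) →ₗ[ℂ] Matrix (Fin 2) (Fin 2) ℂ where
  toFun u := !![Complex.I * u 0, u 1 + Complex.I * u 2; -u 1 + Complex.I * u 2, -(Complex.I * u 0)]
  map_add' u v := by
    ext i j
    fin_cases i <;> fin_cases j <;> simp <;> ring
  map_smul' t u := by
    ext i j
    fin_cases i <;> fin_cases j <;> simp <;> ring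

/-- The coordinates of the trace-free part of a matrix, the left inverse of `traceFreeMatrix`
that vanishes on scalar matrices. -/
def traceFreeCoords (X : Matrix (Fin 2) (Fin 2) ℂ) : Fin 3 → ℂ :=
  ![-Complex.I * (X 0 0 - X 1 1) / 2, (X 0 1 - X 1 0) / 2, -Complex.I * (X 0 1 + X 1 0) / 2]

theorem traceFreeMatrix_apply (u : Fin 3 → ℂ) :
    traceFreeMatrix u =
      !![Complex.I * u 0, u 1 + Complex.I * u 2; -u 1 + Complex.I * u 2, -(Complex.I * u 0)] :=
  rfl

theorem trace_traceFreeMatrix (u : Fin 3 → ℂ) : (traceFreeMatrix u).trace = 0 := by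
  simp [traceFreeMatrix_apply, trace_fin_two]

theorem det_traceFreeMatrix (u : Fin 3 → ℂ) : (traceFreeMatrix u).det = u ⬝ᵥ u := by
  simp only [traceFreeMatrix_apply, det_fin_two_of, dotProduct, Fin.sum_univ_three]
  linear_combination (-u 0 ^ 2 - u 2 ^ 2) * Complex.I_sq

theorem smul_one_add_traceFreeMatrix (t : ℂ) (u : Fin 3 → ℂ) :
    t • 1 + traceFreeMatrix u =
      !![t + Complex.I * u 0, u 1 + Complex.I * u 2;
        -u 1 + Complex.I * u 2, t - Complex.I * u 0] := by
  ext i j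
  fin_cases i <;> fin_cases j <;> simp [traceFreeMatrix_apply, sub_eq_add_neg]

theorem trace_div_two_smul_one_add_traceFreeMatrix (X : Matrix (Fin 2) (Fin 2) ℂ) :
    (X.trace / 2) • 1 + traceFreeMatrix (traceFreeCoords X) = X := by
  conv_rhs => rw [eta_fin_two X]
  rw [smul_one_add_traceFreeMatrix, trace_fin_two]
  simp only [traceFreeCoords, cons_val, EmbeddingLike.apply_eq_iff_eq, vecCons_inj, and_true,
    and_assoc]
  refine ⟨?_, ?_, ?_, ?_⟩
  · linear_combination (X 1 1 - X 0 0) / 2 * Complex.I_sq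
  · linear_combination -(X 0 1 + X 1 0) / 2 * Complex.I_sq
  · linear_combination -(X 0 1 + X 1 0) / 2 * Complex.I_sq
  · linear_combination (X 0 0 - X 1 1) / 2 * Complex.I_sq

theorem traceFreeMatrix_traceFreeCoords {X : Matrix (Fin 2) (Fin 2) ℂ} (h : X.trace = 0) :
    traceFreeMatrix (traceFreeCoords X) = X := by
  simpa only [h, zero_div, zero_smul, zero_add] using trace_div_two_smul_one_add_traceFreeMatrix X

theorem trace_smul_one_add_traceFreeMatrix (t : ℂ) (u : Fin 3 → ℂ) :
    (t • 1 + traceFreeMatrix u).trace = 2 * t := by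
  rw [trace_add, trace_traceFreeMatrix, trace_smul, trace_one, Fintype.card_fin, add_zero,
    smul_eq_mul, Nat.cast_ofNat, mul_comm]

theorem traceFreeCoords_smul_one_add_traceFreeMatrix (t : ℂ) (u : Fin 3 → ℂ) :
    traceFreeCoords (t • 1 + traceFreeMatrix u) = u := by
  conv_rhs => rw [← FinVec.etaExpand_eq u]
  change _ = ![u 0, u 1, u 2]
  rw [smul_one_add_traceFreeMatrix]
  simp only [traceFreeCoords, of_apply, cons_val', cons_val, cons_val_fin_one, vecCons_inj,
    and_true]
  refine ⟨?_, ?_, ?_⟩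
  · linear_combination -u 0 * Complex.I_sq
  · ring
  · linear_combination -u 2 * Complex.I_sq

theorem traceFreeCoords_traceFreeMatrix (u : Fin 3 → ℂ) :
    traceFreeCoords (traceFreeMatrix u) = u := by
  simpa only [zero_smul, zero_add] using traceFreeCoords_smul_one_add_traceFreeMatrix 0 u

theorem traceFreeMatrix_injective : Function.Injective traceFreeMatrix :=
  Function.LeftInverse.injective traceFreeCoords_traceFreeMatrix

theorem eq_zero_of_traceFreeMatrix_diagonal_or_antidiagonal {u : Fin 3 → ℂ}
    (h : (traceFreeMatrix u 0 1 = 0 ∧ traceFreeMatrix u 1 0 = 0) ∨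
      (traceFreeMatrix u 0 0 = 0 ∧ traceFreeMatrix u 1 1 = 0)) :
    (u 1 = 0 ∧ u 2 = 0) ∨ u 0 = 0 := by
  rw [← traceFreeCoords_traceFreeMatrix u]
  refine h.imp (fun ⟨h01, h10⟩ => ?_) (fun ⟨h00, h11⟩ => ?_)
  · simp [traceFreeCoords, h01, h10]
  · simp [traceFreeCoords, h00, h11]

theorem traceFreeMatrix_mul (u v : Fin 3 → ℂ) :
    traceFreeMatrix u * traceFreeMatrix v =
      -(u ⬝ᵥ v) • 1 + traceFreeMatrix (crossProduct u v) := by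
  rw [smul_one_add_traceFreeMatrix, traceFreeMatrix_apply, traceFreeMatrix_apply, mul_fin_two]
  simp only [cross_apply, dotProduct, Fin.sum_univ_three, cons_val, EmbeddingLike.apply_eq_iff_eq,
    vecCons_inj, and_true, and_assoc]
  refine ⟨?_, ?_, ?_, ?_⟩
  · linear_combination (u 0 * v 0 + u 2 * v 2) * Complex.I_sq
  · linear_combination (u 0 * v 2 - u 2 * v 0) * Complex.I_sq
  · linear_combination (u 2 * v 0 - u 0 * v 2) * Complex.I_sq
  · linear_combination (u 0 * v 0 + u 2 * v 2) * Complex.I_sq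

theorem trace_traceFreeMatrix_mul (u v : Fin 3 → ℂ) :
    (traceFreeMatrix u * traceFreeMatrix v).trace = -(2 * (u ⬝ᵥ v)) := by
  rw [traceFreeMatrix_mul, trace_smul_one_add_traceFreeMatrix, mul_neg]

theorem trace_traceFreeMatrix_mul_mul (V : Matrix (Fin 3) (Fin 3) ℂ) :
    (traceFreeMatrix (V 0) * traceFreeMatrix (V 1) * traceFreeMatrix (V 2)).trace =
      -(2 * V.det) := by
  rw [traceFreeMatrix_mul, add_mul, trace_add, trace_traceFreeMatrix_mul, smul_mul_assoc, one_mul,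
    trace_smul, trace_traceFreeMatrix, smul_zero, zero_add, dotProduct_comm,
    ← triple_product_permutation, ← triple_product_permutation, triple_product_eq_det]
  rfl

theorem traceFreeMatrix_mul_neg {u : Fin 3 → ℂ} (hu : u ⬝ᵥ u = 1) :
    traceFreeMatrix u * -traceFreeMatrix u = 1 := by
  rw [mul_neg, traceFreeMatrix_mul, cross_self, hu, map_zero, add_zero, neg_smul, one_smul,
    neg_neg]

/-- In other words, conjugation by `traceFreeMatrix u` is the half turn about `u`. -/
theorem traceFreeMatrix_mul_comm {u : Fin 3 → ℂ} (hu : u ⬝ᵥ u = 1) (v : Fin 3 → ℂ) :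
    traceFreeMatrix v * traceFreeMatrix u =
      traceFreeMatrix u * traceFreeMatrix ((2 * (u ⬝ᵥ v)) • u - v) := by
  rw [map_sub, map_smul, mul_sub, mul_smul_comm, traceFreeMatrix_mul u u, traceFreeMatrix_mul u v,
    traceFreeMatrix_mul v u, cross_self, map_zero, hu, dotProduct_comm v u, ← cross_anticomm v u,
    map_neg]
  module

theorem smul_one_add_traceFreeMatrix_mul (s t : ℂ) (u v : Fin 3 → ℂ) :
    (s • 1 + traceFreeMatrix u) * (t • 1 + traceFreeMatrix v) =
      (s * t - u ⬝ᵥ v) • 1 + traceFreeMatrix (s • v + t • u + crossProduct u v) := by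
  rw [map_add, map_add, map_smul, map_smul, add_mul, mul_add, mul_add, traceFreeMatrix_mul,
    smul_mul_smul_comm, smul_mul_assoc, mul_smul_comm, one_mul, mul_one, one_mul]
  module

/-- The endomorphism of the multiplicative monoid of two by two matrices that fixes the scalar
matrices and acts on the trace-free ones by a rotation of their coordinates. -/
def rotateMatrix (Q : Matrix (Fin 3) (Fin 3) ℂ) (hQ : Q * Qᵀ = 1) (hdet : Q.det = 1) :
    Matrix (Fin 2) (Fin 2) ℂ →* Matrix (Fin 2) (Fin 2) ℂ where
  toFun X := (X.trace / 2) • 1 + traceFreeMatrix (traceFreeCoords X ᵥ* Q)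
  map_one' := by
    have hcoords : traceFreeCoords 1 = 0 := by
      simpa using traceFreeCoords_smul_one_add_traceFreeMatrix 1 0
    rw [hcoords, zero_vecMul, map_zero, add_zero, trace_one, Fintype.card_fin, Nat.cast_ofNat,
      div_self two_ne_zero, one_smul]
  map_mul' X Y := by
    rw [smul_one_add_traceFreeMatrix_mul, dotProduct_vecMul_vecMul_of_mul_transpose_eq_one hQ,
      crossProduct_vecMul_of_mul_transpose_eq_one hQ hdet, ← smul_vecMul, ← smul_vecMul,
      ← add_vecMul, ← add_vecMul]
    have hXY := smul_one_add_traceFreeMatrix_mul (X.trace / 2) (Y.trace / 2)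
      (traceFreeCoords X) (traceFreeCoords Y)
    simp only [trace_div_two_smul_one_add_traceFreeMatrix] at hXY
    rw [hXY, trace_smul_one_add_traceFreeMatrix, traceFreeCoords_smul_one_add_traceFreeMatrix,
      mul_div_cancel_left₀ _ two_ne_zero]

variable {Q : Matrix (Fin 3) (Fin 3) ℂ} (hQ : Q * Qᵀ = 1) (hdet : Q.det = 1)

theorem trace_rotateMatrix (X : Matrix (Fin 2) (Fin 2) ℂ) :
    (rotateMatrix Q hQ hdet X).trace = X.trace :=
  (trace_smul_one_add_traceFreeMatrix _ _).trans (mul_div_cancel₀ _ two_ne_zero)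

theorem rotateMatrix_traceFreeMatrix (u : Fin 3 → ℂ) :
    rotateMatrix Q hQ hdet (traceFreeMatrix u) = traceFreeMatrix (u ᵥ* Q) := by
  simp [rotateMatrix, trace_traceFreeMatrix, traceFreeCoords_traceFreeMatrix]

theorem star_traceFreeMatrix (u : Fin 3 → ℂ) :
    star (traceFreeMatrix u) = -traceFreeMatrix (star u) := by
  ext i j
  fin_cases i <;> fin_cases j <;> simp [traceFreeMatrix_apply, star_apply, add_comm]

theorem traceFreeMatrix_mem_specialUnitaryGroup_iff {u : Fin 3 → ℂ} :
    traceFreeMatrix u ∈ specialUnitaryGroup (Fin 2) ℂ ↔ u ⬝ᵥ u = 1 ∧ star u = u := by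
  rw [mem_specialUnitaryGroup_iff, det_traceFreeMatrix, mem_unitaryGroup_iff, and_comm]
  refine and_congr_right fun hu => ?_
  rw [star_traceFreeMatrix]
  constructor <;> intro h
  · have hinv : -traceFreeMatrix u * traceFreeMatrix u = 1 := by
      rw [neg_mul, ← mul_neg, traceFreeMatrix_mul_neg hu]
    exact traceFreeMatrix_injective (neg_inj.1 (left_inv_eq_right_inv hinv h)).symm
  · rw [h, traceFreeMatrix_mul_neg hu]

theorem matrixP_inv_mul_matrixT_mul_matrixP {β : ℂ} (hβ : β ≠ 0) (a b e : ℂ) :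
    (matrixP β)⁻¹ * (matrixT β * !![a, b; -(β ^ 2 * b), e - a]) * matrixP β =
      traceFreeMatrix ![e / 2, Complex.I * (a - e / 2), -(β * b)] := by
  have hP : IsUnit (matrixP β).det := by
    rw [isUnit_iff_ne_zero, matrixP, det_fin_two_of, ← mul_sub]
    exact mul_ne_zero (inv_ne_zero hβ) (by norm_num)
  have hconj : matrixT β * !![a, b; -(β ^ 2 * b), e - a] * matrixP β =
      matrixP β * traceFreeMatrix ![e / 2, Complex.I * (a - e / 2), -(β * b)] := by
    simp only [matrixT, matrixP, traceFreeMatrix_apply, mul_fin_two, cons_val,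
      EmbeddingLike.apply_eq_iff_eq, vecCons_inj, and_true, and_assoc]
    field_simp
    refine ⟨?_, ?_, ?_, ?_⟩ <;> ring
  rw [Matrix.mul_assoc, hconj, nonsing_inv_mul_cancel_left (matrixP β) _ hP]

end TraceFreeMatrices

theorem semiconjBy_zpow_units {G : Type*} [Group G] {x y z : G} (hxy : SemiconjBy x y z)
    (hyx : SemiconjBy x z y) (s : ℤˣ) : SemiconjBy (x ^ (s : ℤ)) y z := by
  rcases Int.units_eq_one_or s with rfl | rfl
  · rwa [Units.val_one, zpow_one]
  · rw [Units.val_neg, Units.val_one, _root_.zpow_neg_one]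
    exact hyx.inv_symm_left

section RealNumbers

theorem isSelfAdjoint_of_sq_eq_ofReal {z : ℂ} {x : ℝ} (hx : 0 ≤ x) (h : z ^ 2 = x) :
    IsSelfAdjoint z := by
  have hsq : z ^ 2 = (Real.sqrt x : ℂ) ^ 2 := by rw [h, ← Complex.ofReal_pow, Real.sq_sqrt hx]
  rcases sq_eq_sq_iff_eq_or_eq_neg.1 hsq with rfl | rfl
  · exact Complex.conj_ofReal _
  · exact IsSelfAdjoint.neg (Complex.conj_ofReal _)

theorem abs_dotProduct_le_one {n : Type*} [Fintype n] {x y : n → ℝ} (hx : x ⬝ᵥ x = 1)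
    (hy : y ⬝ᵥ y = 1) : |x ⬝ᵥ y| ≤ 1 := by
  have h := Finset.sum_mul_sq_le_sq_mul_sq Finset.univ x y
  simp only [sq] at h
  rw [← sq_le_one_iff_abs_le_one, sq]
  exact h.trans_eq ((congrArg₂ (· * ·) hx hy).trans (one_mul 1))

theorem sq_add_sq_add_sq_sub_mul_nonneg {x y z : ℝ} (hz : z ∈ Set.Icc (-2 : ℝ) 2) :
    0 ≤ x ^ 2 + y ^ 2 + z ^ 2 - x * y * z := by
  nlinarith [mul_nonneg (sub_nonneg.2 hz.2) (sq_nonneg (x + y)),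
    mul_nonneg (sub_nonneg.2 hz.1) (sq_nonneg (x - y)), sq_nonneg z]

theorem mem_Ioo_of_sq_add_sq_add_sq_sub_mul_lt {x y z : ℝ} (hx : x ∈ Set.Icc (-2 : ℝ) 2)
    (h : x ^ 2 + y ^ 2 + z ^ 2 - x * y * z < 4) : x ∈ Set.Ioo (-2 : ℝ) 2 := by
  refine ⟨lt_of_le_of_ne hx.1 ?_, lt_of_le_of_ne hx.2 ?_⟩
  · rintro rfl
    nlinarith [sq_nonneg (y + z)]
  · rintro rfl
    nlinarith [sq_nonneg (y - z)]

end RealNumbers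

namespace KnotDiagram

section

variable {D : KnotDiagram} {ε : D.PairCoords}

theorem cordMatrix_self (ε : D.PairCoords) (r : D.Arc) : D.cordMatrix ε r r = 2 := by
  simp [cordMatrix]

theorem cordMatrix_isSymm (ε : D.PairCoords) : (D.cordMatrix ε).IsSymm := by
  ext r s
  have hrs : s(s, r) = s(r, s) := Sym2.eq_swap
  simp only [cordMatrix, transpose_apply, of_apply]
  congr! 2
  exact Subtype.ext hrs

theorem cordMatrix_comm (ε : D.PairCoords) (r s : D.Arc) :
    D.cordMatrix ε r s = D.cordMatrix ε s r :=
  (cordMatrix_isSymm ε).apply s r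

theorem cordMatrix_eq_of_ne_imp {M : Matrix D.Arc D.Arc ℂ} (hdiag : ∀ r, M r r = 2)
    (h : ∀ r s, r ≠ s → M r s = D.cordMatrix ε r s) (r s : D.Arc) : D.cordMatrix ε r s = M r s := by
  rcases eq_or_ne r s with rfl | hrs
  · rw [cordMatrix_self, hdiag]
  · exact (h r s hrs).symm

/-- The rows of `U` are vectors of the quadratic space `ℂ³`, one for each arc, of which `[ε_rs] / 2`
is the Gram matrix. -/
def IsVectorModel (ε : D.PairCoords) (U : Matrix D.Arc (Fin 3) ℂ) : Prop :=
  D.cordMatrix ε = (2 : ℂ) • (U * Uᵀ)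

/-- A vector model in which the vectors of the arcs `a` span a parallelepiped of oriented volume
`σ / 2`. -/
structure IsOrientedModel (ε : D.PairCoords) (a : Fin 3 → D.Arc) (σ : ℂ)
    (U : Matrix D.Arc (Fin 3) ℂ) : Prop where
  isVectorModel : IsVectorModel ε U
  two_mul_det : 2 * (U.submatrix a id).det = σ

variable {U : Matrix D.Arc (Fin 3) ℂ} {a : Fin 3 → D.Arc} {σ : ℂ}

theorem IsVectorModel.apply (hU : IsVectorModel ε U) (r s : D.Arc) :
    D.cordMatrix ε r s = 2 * (U r ⬝ᵥ U s) :=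
  congrFun (congrFun hU r) s

theorem IsVectorModel.dotProduct_self (hU : IsVectorModel ε U) (r : D.Arc) : U r ⬝ᵥ U r = 1 := by
  have h := hU.apply r r
  rw [cordMatrix_self] at h
  linear_combination -h / 2

theorem IsVectorModel.minor_eq (hU : IsVectorModel ε U) (a : Fin 3 → D.Arc) :
    D.minor ε a = 8 * (U.submatrix a id).det ^ 2 := by
  have hgram : (D.cordMatrix ε).submatrix a a =
      (2 : ℂ) • (U.submatrix a id * (U.submatrix a id)ᵀ) := congrArg (·.submatrix a a) hU
  rw [minor, hgram, det_smul, det_mul, det_transpose, Fintype.card_fin]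
  ring

theorem IsVectorModel.isUnit_det (hU : IsVectorModel ε U) (ha : D.minor ε a ≠ 0) :
    IsUnit (U.submatrix a id).det := by
  rw [isUnit_iff_ne_zero]
  contrapose ha
  rw [hU.minor_eq, ha]
  ring

theorem IsVectorModel.neg (hU : IsVectorModel ε U) : IsVectorModel ε (-U) := by
  rwa [IsVectorModel, transpose_neg, Matrix.neg_mul, Matrix.mul_neg, neg_neg]

theorem exists_isVectorModel (hrank : D.augRank ε = 3) :
    ∃ U : Matrix D.Arc (Fin 3) ℂ, IsVectorModel ε U := by
  have hsymm : ((2⁻¹ : ℂ) • D.cordMatrix ε).IsSymm := (cordMatrix_isSymm ε).smul _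
  have hrank' : ((2⁻¹ : ℂ) • D.cordMatrix ε).rank = 3 := by
    rwa [rank_smul_of_mem_nonZeroDivisors _
      (mem_nonZeroDivisors_of_ne_zero (inv_ne_zero two_ne_zero))]
  obtain ⟨U, hU⟩ := exists_eq_mul_transpose_of_rank_eq hsymm hrank'
  exact ⟨U, by rw [IsVectorModel, ← hU, smul_inv_smul₀ two_ne_zero]⟩

theorem IsVectorModel.two_mul_det_eq_or (hU : IsVectorModel ε U) (hσ : σ ^ 2 = D.minor ε a / 2) :
    2 * (U.submatrix a id).det = σ ∨ 2 * (U.submatrix a id).det = -σ := by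
  rw [hU.minor_eq] at hσ
  exact sq_eq_sq_iff_eq_or_eq_neg.1 (by linear_combination -hσ)

theorem exists_isOrientedModel (hrank : D.augRank ε = 3) (hσ : σ ^ 2 = D.minor ε a / 2) :
    ∃ U : Matrix D.Arc (Fin 3) ℂ, IsOrientedModel ε a σ U := by
  obtain ⟨U, hU⟩ := exists_isVectorModel hrank
  rcases hU.two_mul_det_eq_or hσ with h | h
  · exact ⟨U, hU, h⟩
  · refine ⟨-U, hU.neg, ?_⟩
    rw [submatrix_neg, Pi.neg_apply, Pi.neg_apply, det_neg, Fintype.card_fin]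
    linear_combination -h

theorem isVectorModel_of_submatrix_eq (hrank : D.augRank ε = 3) (ha : D.minor ε a ≠ 0)
    (h : (D.cordMatrix ε).submatrix id a = (2 : ℂ) • (U * (U.submatrix a id)ᵀ)) :
    IsVectorModel ε U := by
  have hUU : (2 : ℂ) • (U * Uᵀ) = U * ((2 : ℂ) • Uᵀ) := (Matrix.mul_smul _ _ _).symm
  refine eq_of_submatrix_eq (cordMatrix_isSymm ε) ?_ (le_of_eq hrank) ?_ ha h
  · rw [IsSymm, transpose_smul, transpose_mul, transpose_transpose]
  · rw [hUU]
    exact (rank_mul_le_left _ _).trans ((rank_le_card_width U).trans (Fintype.card_fin 3).le)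

theorem IsVectorModel.underOut_eq (hU : IsVectorModel ε U) (hε : ε ∈ D.augVariety)
    (ha : D.minor ε a ≠ 0) (c : Fin D.n) :
    U (D.underOut c) =
      (2 * (U (D.overArc c) ⬝ᵥ U (D.underIn c))) • U (D.overArc c) - U (D.underIn c) := by
  refine mulVec_injective_of_isUnit ((isUnit_iff_isUnit_det _).2 (hU.isUnit_det ha)) ?_
  ext i
  have h := hε c (a i)
  simp only [hU.apply] at h
  change U (a i) ⬝ᵥ _ = U (a i) ⬝ᵥ _
  rw [dotProduct_sub, dotProduct_smul, smul_eq_mul]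
  linear_combination h / 2

theorem knotGroup_hom_ext {M : Type*} [Monoid M] {ψ ψ' : D.KnotGroup →* M}
    (h : ∀ l, ψ (D.meridian l) = ψ' (D.meridian l)) : ψ = ψ' :=
  MonoidHom.eq_of_eqOn_dense (PresentedGroup.closure_range_of _) (Set.forall_mem_range.2 h)

theorem exists_knotGroup_hom {G : Type*} [Group G] (g : D.Arc → G)
    (h : ∀ c, g (D.underIn c) * g (D.overArc c) ^ (D.sign c : ℤ) =
      g (D.overArc c) ^ (D.sign c : ℤ) * g (D.underOut c)) :
    ∃ ρ : D.KnotGroup →* G, ∀ l, ρ (D.meridian l) = g l := by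
  have hrel : ∀ r ∈ D.wirtingerRels, FreeGroup.lift g r = 1 := by
    rintro _ ⟨c, rfl⟩
    simp only [map_mul, map_zpow, map_inv, FreeGroup.lift_apply_of, h c]
    group
  exact ⟨PresentedGroup.toGroup hrel, fun l => PresentedGroup.toGroup.of hrel⟩

theorem IsVectorModel.exists_hom (hU : IsVectorModel ε U) (hε : ε ∈ D.augVariety)
    (ha : D.minor ε a ≠ 0) {G : Type*} [Group G] {j : G →* Matrix (Fin 2) (Fin 2) ℂ}
    (hj : Function.Injective j) {g : D.Arc → G} (hg : ∀ l, j (g l) = traceFreeMatrix (U l)) :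
    ∃ ρ : D.KnotGroup →* G, ∀ l, ρ (D.meridian l) = g l := by
  refine exists_knotGroup_hom g fun c => (semiconjBy_zpow_units (hj ?_) (hj ?_) _).symm
  · rw [map_mul, map_mul, hg, hg, hg, hU.underOut_eq hε ha,
      ← traceFreeMatrix_mul_comm (hU.dotProduct_self _)]
  · have hin : U (D.underIn c) =
        (2 * (U (D.overArc c) ⬝ᵥ U (D.underOut c))) • U (D.overArc c) - U (D.underOut c) := by
      rw [hU.underOut_eq hε ha, dotProduct_sub, dotProduct_smul, hU.dotProduct_self, smul_eq_mul]
      module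
    rw [map_mul, map_mul, hg, hg, hg, hin, ← traceFreeMatrix_mul_comm (hU.dotProduct_self _)]

/-- The matrix representation `ψ` is trace-free on meridians, and the rows of `U` are the
coordinates of their images. -/
def HasMeridianCoords (ψ : D.KnotGroup →* Matrix (Fin 2) (Fin 2) ℂ)
    (U : Matrix D.Arc (Fin 3) ℂ) : Prop :=
  ∀ l, ψ (D.meridian l) = traceFreeMatrix (U l)

variable {ψ ψ' : D.KnotGroup →* Matrix (Fin 2) (Fin 2) ℂ} {U' : Matrix D.Arc (Fin 3) ℂ}
  {χ χ' : D.KnotGroup → ℂ}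

theorem exists_hasMeridianCoords (h : ∀ l, (ψ (D.meridian l)).trace = 0) :
    ∃ U, HasMeridianCoords ψ U :=
  ⟨of fun l => traceFreeCoords (ψ (D.meridian l)),
    fun l => (traceFreeMatrix_traceFreeCoords (h l)).symm⟩

theorem HasMeridianCoords.trace_mul_inv (hψ : HasMeridianCoords ψ U) (r : D.Arc) {s : D.Arc}
    (hs : U s ⬝ᵥ U s = 1) :
    (ψ (D.meridian r * (D.meridian s)⁻¹)).trace = 2 * (U r ⬝ᵥ U s) := by
  have hinv : ψ (D.meridian s)⁻¹ = -traceFreeMatrix (U s) :=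
    left_inv_eq_right_inv (by rw [← map_mul, inv_mul_cancel, map_one])
      (by rw [hψ, traceFreeMatrix_mul_neg hs])
  rw [map_mul, hinv, hψ, mul_neg, trace_neg, trace_traceFreeMatrix_mul, neg_neg]

theorem HasMeridianCoords.trace_triple (hψ : HasMeridianCoords ψ U) (a : Fin 3 → D.Arc) :
    (ψ (D.meridian (a 0) * D.meridian (a 1) * D.meridian (a 2))).trace =
      -(2 * (U.submatrix a id).det) := by
  rw [map_mul, map_mul, hψ, hψ, hψ]
  exact trace_traceFreeMatrix_mul_mul (U.submatrix a id)

theorem IsFrakX.isOrientedModel (hχ : D.IsFrakX ε a σ χ) (htr : ∀ g, χ g = (ψ g).trace)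
    (hdet : ∀ l, (ψ (D.meridian l)).det = 1) (hψ : HasMeridianCoords ψ U) :
    IsOrientedModel ε a σ U := by
  have hone : ∀ l, U l ⬝ᵥ U l = 1 := fun l => by rw [← det_traceFreeMatrix, ← hψ, hdet]
  obtain ⟨-, hpair, htriple⟩ := hχ
  constructor
  · ext r s
    refine cordMatrix_eq_of_ne_imp (M := (2 : ℂ) • (U * Uᵀ)) (fun l => ?_) (fun r s hrs => ?_) r s
    · exact (congrArg (2 * ·) (hone l)).trans (mul_one 2)
    · rw [← hpair r s hrs, htr, hψ.trace_mul_inv r (hone s)]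
      rfl
  · rw [← htriple, htr, hψ.trace_triple, neg_neg]

theorem IsOrientedModel.isFrakX (hU : IsOrientedModel ε a σ U)
    {ρ : D.KnotGroup →* SpecialLinearGroup (Fin 2) ℂ}
    (hρ : HasMeridianCoords (SpecialLinearGroup.coeMonoidHom.comp ρ) U) :
    D.IsFrakX ε a σ fun g => (ρ g : Matrix (Fin 2) (Fin 2) ℂ).trace := by
  refine ⟨⟨ρ, fun r => ?_, fun g => rfl⟩, fun r s _ => ?_, ?_⟩
  · exact (congrArg trace (hρ r)).trans (trace_traceFreeMatrix _)
  · exact (hρ.trace_mul_inv r (hU.isVectorModel.dotProduct_self s)).trans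
      (hU.isVectorModel.apply r s).symm
  · exact neg_eq_iff_eq_neg.2 ((hρ.trace_triple a).trans (congrArg Neg.neg hU.two_mul_det))

theorem exists_isFrakX (hε : ε ∈ D.augVariety) (hrank : D.augRank ε = 3) (ha : D.minor ε a ≠ 0)
    (hσ : σ ^ 2 = D.minor ε a / 2) : ∃ χ, D.IsFrakX ε a σ χ := by
  obtain ⟨U, hU⟩ := exists_isOrientedModel hrank hσ
  have hdet : ∀ l, (traceFreeMatrix (U l)).det = 1 := fun l => by
    rw [det_traceFreeMatrix, hU.isVectorModel.dotProduct_self]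
  obtain ⟨ρ, hρ⟩ := hU.isVectorModel.exists_hom hε ha SpecialLinearGroup.coeMonoidHom_injective
    (g := fun l => ⟨traceFreeMatrix (U l), hdet l⟩) fun l => rfl
  exact ⟨_, hU.isFrakX fun l => congrArg Subtype.val (hρ l)⟩

theorem IsOrientedModel.trace_eq (hU : IsOrientedModel ε a σ U) (hU' : IsOrientedModel ε a σ U')
    (ha : D.minor ε a ≠ 0) (hψ : HasMeridianCoords ψ U) (hψ' : HasMeridianCoords ψ' U')
    (g : D.KnotGroup) : (ψ g).trace = (ψ' g).trace := by
  have hgram : U * Uᵀ = U' * U'ᵀ :=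
    smul_right_injective _ (two_ne_zero (α := ℂ)) (hU.isVectorModel.symm.trans hU'.isVectorModel)
  have hdet : (U.submatrix a id).det = (U'.submatrix a id).det :=
    mul_left_cancel₀ two_ne_zero (hU.two_mul_det.trans hU'.two_mul_det.symm)
  obtain ⟨Q, hQ, hQdet, hUQ⟩ :=
    exists_rotation_of_mul_transpose_eq hgram (hU.isVectorModel.isUnit_det ha) hdet
  have hrot : (rotateMatrix Q hQ hQdet).comp ψ = ψ' := knotGroup_hom_ext fun l => by
    rw [MonoidHom.comp_apply, hψ, hψ', rotateMatrix_traceFreeMatrix, ← hUQ]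
    rfl
  rw [← hrot, MonoidHom.comp_apply, trace_rotateMatrix]

theorem IsFrakX.exists_isOrientedModel (hχ : D.IsFrakX ε a σ χ) :
    ∃ (ψ : D.KnotGroup →* Matrix (Fin 2) (Fin 2) ℂ) (U : Matrix D.Arc (Fin 3) ℂ),
      (∀ g, χ g = (ψ g).trace) ∧ HasMeridianCoords ψ U ∧ IsOrientedModel ε a σ U := by
  obtain ⟨ρ, htrace, hρ⟩ := hχ.1
  obtain ⟨ψ, hψ⟩ : ∃ ψ : D.KnotGroup →* Matrix (Fin 2) (Fin 2) ℂ, ∀ g, ψ g = ρ g :=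
    ⟨SpecialLinearGroup.coeMonoidHom.comp ρ, fun g => rfl⟩
  simp only [← hψ] at htrace hρ
  obtain ⟨U, hU⟩ := exists_hasMeridianCoords htrace
  exact ⟨ψ, U, hρ, hU, hχ.isOrientedModel hρ (fun l => hψ _ ▸ (ρ (D.meridian l)).2) hU⟩

theorem IsFrakX.eq_trace (hχ : D.IsFrakX ε a σ χ) (ha : D.minor ε a ≠ 0)
    (hU : IsOrientedModel ε a σ U) (hψ : HasMeridianCoords ψ U) (g : D.KnotGroup) :
    χ g = (ψ g).trace := by
  obtain ⟨ψ', U', htrace, hU', hmodel⟩ := hχ.exists_isOrientedModel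
  exact (htrace g).trans (hmodel.trace_eq hU ha hU' hψ g)

theorem IsFrakX.unique (hχ : D.IsFrakX ε a σ χ) (hχ' : D.IsFrakX ε a σ χ')
    (ha : D.minor ε a ≠ 0) : χ' = χ := by
  obtain ⟨ψ, U, htrace, hU, hmodel⟩ := hχ.exists_isOrientedModel
  ext g
  rw [hχ'.eq_trace ha hmodel hU, htrace]

theorem IsFrakX.exists_isSelfAdjoint_model (hχ : D.IsFrakX ε a σ χ)
    {ρ : D.KnotGroup →* specialUnitaryGroup (Fin 2) ℂ} (hρ : D.IsCharacterOf χ ρ) :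
    ∃ U, IsVectorModel ε U ∧ (∀ l, IsSelfAdjoint (U l)) ∧
      ∀ l, (ρ (D.meridian l) : Matrix (Fin 2) (Fin 2) ℂ) = traceFreeMatrix (U l) := by
  obtain ⟨ψ, hψ⟩ : ∃ ψ : D.KnotGroup →* Matrix (Fin 2) (Fin 2) ℂ, ∀ g, ψ g = ρ g :=
    ⟨(specialUnitaryGroup (Fin 2) ℂ).subtype.comp ρ, fun g => rfl⟩
  obtain ⟨ρ', htrace, hρ'⟩ := hχ.1
  obtain ⟨U, hU⟩ := exists_hasMeridianCoords (ψ := ψ) fun l => by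
    rw [hψ, ← hρ, hρ', htrace]
  have hmem : ∀ l, traceFreeMatrix (U l) ∈ specialUnitaryGroup (Fin 2) ℂ := fun l => by
    rw [← hU, hψ]
    exact (ρ (D.meridian l)).2
  have hmodel : IsOrientedModel ε a σ U := hχ.isOrientedModel (fun g => by rw [hψ, hρ])
    (fun l => by rw [hU, (mem_specialUnitaryGroup_iff.1 (hmem l)).2]) hU
  exact ⟨U, hmodel.isVectorModel,
    fun l => (traceFreeMatrix_mem_specialUnitaryGroup_iff.1 (hmem l)).2, fun l => by rw [← hψ, hU]⟩

theorem eq_of_underIn_eq_underOut {β : Type*} {f : D.Arc → β}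
    (h : ∀ c, f (D.underIn c) = f (D.underOut c)) (r s : D.Arc) : f r = f s := by
  have hnext : ∀ p : Fin D.n × Bool, f (Quot.mk _ (D.next p)) = f (Quot.mk _ p) := by
    intro p
    rcases hp : D.next p with ⟨c, _ | _⟩
    · rw [← D.next.symm_apply_apply p, hp]
      exact (h c).symm
    · exact congrArg f (Quot.sound ⟨hp.symm, rfl⟩).symm
  have hpow : ∀ (n : ℕ) (p : Fin D.n × Bool),
      f (Quot.mk _ ((D.next ^ n) p)) = f (Quot.mk _ p) := by
    intro n
    induction n with
    | zero => exact fun p => rfl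
    | succ n ih => exact fun p => (ih (D.next p)).trans (hnext p)
  induction r using Quot.ind with | _ p
  induction s using Quot.ind with | _ q
  obtain ⟨n, rfl⟩ := (D.one_component.2 (Set.mem_univ p) (Set.mem_univ q)).exists_nat_pow_eq
  exact (hpow n p).symm

theorem IsVectorModel.exists_coord_eq_zero (hU : IsVectorModel ε U) (hε : ε ∈ D.augVariety)
    (ha : D.minor ε a ≠ 0) (haxis : ∀ l, (U l 1 = 0 ∧ U l 2 = 0) ∨ U l 0 = 0) :
    ∃ i, ∀ l, U l i = 0 := by
  have hsq : ∀ c, U (D.underIn c) 0 ^ 2 = U (D.underOut c) 0 ^ 2 := by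
    intro c
    have hone := hU.dotProduct_self (D.overArc c)
    rw [hU.underOut_eq hε ha, Pi.sub_apply, Pi.smul_apply, smul_eq_mul]
    simp only [dotProduct, Fin.sum_univ_three] at hone ⊢
    rcases haxis (D.overArc c) with ⟨h1, h2⟩ | h0
    · have hsq0 : U (D.overArc c) 0 ^ 2 = 1 := by simpa [h1, h2, sq] using hone
      rw [h1, h2]
      linear_combination (-4 * U (D.overArc c) 0 ^ 2 * U (D.underIn c) 0 ^ 2) * hsq0
    · rw [h0]
      ring
  by_cases h0 : ∃ s, U s 0 = 0
  · obtain ⟨s, hs⟩ := h0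
    refine ⟨0, fun l => pow_eq_zero_iff two_ne_zero |>.1 ?_⟩
    rw [eq_of_underIn_eq_underOut (f := fun l => U l 0 ^ 2) hsq l s, hs, zero_pow two_ne_zero]
  · exact ⟨1, fun l => ((haxis l).resolve_right (not_exists.1 h0 l)).1⟩

theorem IsFrakX.not_isBinaryDihedralCharacter (hχ : D.IsFrakX ε a σ χ) (hε : ε ∈ D.augVariety)
    (ha : D.minor ε a ≠ 0) : ¬ D.IsBinaryDihedralCharacter χ := by
  rintro ⟨ρ, hρ, hdihedral⟩
  obtain ⟨U, hU, -, hρU⟩ := hχ.exists_isSelfAdjoint_model hρ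
  obtain ⟨i, hi⟩ := hU.exists_coord_eq_zero hε ha fun l =>
    eq_zero_of_traceFreeMatrix_diagonal_or_antidiagonal (hρU l ▸ hdihedral (D.meridian l))
  exact (hU.isUnit_det ha).ne_zero (det_eq_zero_of_column_eq_zero i fun j => hi (a j))

theorem triple_eq (ε : D.PairCoords) (r s t : D.Arc) :
    D.triple ε r s t = 2 - D.minor ε ![r, s, t] / 2 := by
  rw [triple, minor, det_fin_three]
  simp only [submatrix_apply, cons_val_zero, cons_val_one, cons_val, cordMatrix_self,
    cordMatrix_comm ε s r, cordMatrix_comm ε t r, cordMatrix_comm ε t s]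
  ring

theorem triple_ne_two_iff {r s t : D.Arc} :
    D.triple ε r s t ≠ 2 ↔ D.minor ε ![r, s, t] ≠ 0 := by
  rw [triple_eq, Ne, sub_eq_self, div_eq_zero_iff, or_iff_left two_ne_zero]

theorem IsVectorModel.isElliptic_of_isSelfAdjoint (hU : IsVectorModel ε U)
    (hreal : ∀ l, IsSelfAdjoint (U l)) : D.IsElliptic ε := by
  obtain ⟨X, rfl⟩ : ∃ X : Matrix D.Arc (Fin 3) ℝ, U = X.map Complex.ofReal :=
    ⟨U.map Complex.re, ext fun l i => (Complex.conj_eq_iff_re.1 (congrFun (hreal l) i)).symm⟩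
  have hcord : ∀ r s, D.cordMatrix ε r s = (2 * (X r ⬝ᵥ X s) : ℝ) := fun r s => by
    rw [hU.apply, Complex.ofReal_mul]
    exact congrArg _ (RingHom.map_dotProduct Complex.ofRealHom (X r) (X s)).symm
  have hone : ∀ r, X r ⬝ᵥ X r = 1 := fun r => by
    have h := hcord r r
    rw [cordMatrix_self] at h
    norm_cast at h
    linarith
  have hmem : ∀ r s, 2 * (X r ⬝ᵥ X s) ∈ Set.Icc (-2 : ℝ) 2 := fun r s => by
    have h := abs_le.1 (abs_dotProduct_le_one (hone r) (hone s))
    constructor <;> linarith [h.1, h.2]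
  refine ⟨fun r s _ => ⟨_, hmem r s, (hcord r s).symm⟩, fun r s t _ _ _ => ?_⟩
  have htriple : D.triple ε r s t = (2 - 4 * (X.submatrix ![r, s, t] id).det ^ 2 : ℝ) := by
    have hdet := RingHom.map_det Complex.ofRealHom (X.submatrix ![r, s, t] id)
    rw [triple_eq, hU.minor_eq]
    push_cast
    rw [← Complex.ofRealHom_eq_coe, hdet, RingHom.mapMatrix_apply, submatrix_map]
    change 2 - 8 * ((X.map Complex.ofReal).submatrix ![r, s, t] id).det ^ 2 / 2 =
      2 - 4 * ((X.map Complex.ofReal).submatrix ![r, s, t] id).det ^ 2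
    ring
  refine ⟨_, ⟨?_, by linarith [sq_nonneg (X.submatrix ![r, s, t] id).det]⟩, htriple.symm⟩
  have hlow := sq_add_sq_add_sq_sub_mul_nonneg (x := 2 * (X r ⬝ᵥ X s)) (y := 2 * (X r ⬝ᵥ X t))
    (hmem s t)
  simp only [triple, hcord] at htriple
  norm_cast at htriple
  linarith

theorem IsElliptic.isSelfAdjoint_cordMatrix (h : D.IsElliptic ε) (r s : D.Arc) :
    IsSelfAdjoint (D.cordMatrix ε r s) := by
  rcases eq_or_ne r s with rfl | hrs
  · rw [cordMatrix_self]
    exact .ofNat 2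
  · obtain ⟨x, -, hx⟩ := h.1 r s hrs
    exact hx ▸ Complex.conj_ofReal x

theorem IsElliptic.isGoodTriple (h : D.IsElliptic ε) (ha : D.minor ε a ≠ 0) :
    D.IsGoodTriple ε (a 0) (a 1) (a 2) := by
  have hinj : Function.Injective a := fun i j hij => by
    by_contra hne
    exact ha (det_zero_of_row_eq hne (by ext k; simp only [submatrix_apply, hij]))
  have h01 : a 0 ≠ a 1 := hinj.ne (by decide)
  have h02 : a 0 ≠ a 2 := hinj.ne (by decide)
  have h12 : a 1 ≠ a 2 := hinj.ne (by decide)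
  obtain ⟨x, hx, hxe⟩ := h.1 _ _ h01
  obtain ⟨y, -, hye⟩ := h.1 _ _ h02
  obtain ⟨z, -, hze⟩ := h.1 _ _ h12
  obtain ⟨t, ht, hte⟩ := h.2 _ _ _ h01 h02 h12
  have ht2 : t ≠ 2 := by
    have hvec : ![a 0, a 1, a 2] = a := FinVec.etaExpand_eq a
    have htriple : D.triple ε (a 0) (a 1) (a 2) ≠ 2 := triple_ne_two_iff.2 (by rwa [hvec])
    rw [← hte] at htriple
    exact_mod_cast htriple
  have htlt : t < 2 := lt_of_le_of_ne ht.2 ht2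
  have hxyz : t = x ^ 2 + y ^ 2 + z ^ 2 - x * y * z - 2 := by
    rw [triple, ← hxe, ← hye, ← hze] at hte
    exact_mod_cast hte
  exact ⟨⟨x, mem_Ioo_of_sq_add_sq_add_sq_sub_mul_lt (y := y) (z := z) hx (by linarith), hxe⟩,
    t, htlt, hte⟩

theorem IsGoodTriple.minor_ne_zero {p q r : D.Arc} (h : D.IsGoodTriple ε p q r) :
    D.minor ε ![p, q, r] ≠ 0 := by
  obtain ⟨-, t, ht, hte⟩ := h
  rw [← triple_ne_two_iff, ← hte]
  exact_mod_cast ht.ne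

section Explicit

variable {p q r : D.Arc} {d β : ℂ}

/-- The upper right entry `b_l` of `A_l`, chosen so that the rows of `explicitModel` at `r` and `l`
have inner product `ε_rl / 2`. -/
def bEntry (ε : D.PairCoords) (p q r : D.Arc) (d : ℂ) (l : D.Arc) : ℂ :=
  (D.cordMatrix ε r l / 2 + D.aEntry ε p q d r * D.aEntry ε p q d l
    - (D.aEntry ε p q d r * D.cordMatrix ε p l + D.aEntry ε p q d l * D.cordMatrix ε p r) / 2)
    / D.alpha ε p q r d

/-- The matrices `A_l`; their lower left entry is `c_l = -α b_l`. -/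
def traceFamily (ε : D.PairCoords) (p q r : D.Arc) (d : ℂ) (l : D.Arc) : Matrix (Fin 2) (Fin 2) ℂ :=
  !![D.aEntry ε p q d l, bEntry ε p q r d l;
    -(D.alpha ε p q r d * bEntry ε p q r d l), D.cordMatrix ε p l - D.aEntry ε p q d l]

/-- The coordinates of the trace-free matrices `P⁻¹ (T A_l) P`: they are the coordinates of the
vectors of a model in an orthonormal basis adapted to the vectors of the arcs `p, q, r`. -/
def explicitModel (ε : D.PairCoords) (p q r : D.Arc) (d β : ℂ) : Matrix D.Arc (Fin 3) ℂ :=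
  of fun l => ![D.cordMatrix ε p l / 2,
    Complex.I * (D.aEntry ε p q d l - D.cordMatrix ε p l / 2), -(β * bEntry ε p q r d l)]

theorem explicitModel_dotProduct (l k : D.Arc) :
    explicitModel ε p q r d β l ⬝ᵥ explicitModel ε p q r d β k =
      (D.aEntry ε p q d k * D.cordMatrix ε p l + D.aEntry ε p q d l * D.cordMatrix ε p k) / 2
        - D.aEntry ε p q d l * D.aEntry ε p q d k
        + β ^ 2 * bEntry ε p q r d l * bEntry ε p q r d k := by
  simp only [explicitModel, dotProduct, Fin.sum_univ_three, of_apply, cons_val_zero, cons_val_one,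
    cons_val]
  linear_combination (D.aEntry ε p q d l - D.cordMatrix ε p l / 2) *
    (D.aEntry ε p q d k - D.cordMatrix ε p k / 2) * Complex.I_sq

theorem det_submatrix_explicitModel_neg (a : Fin 3 → D.Arc) :
    ((explicitModel ε p q r d (-β)).submatrix a id).det =
      -((explicitModel ε p q r d β).submatrix a id).det := by
  simp only [explicitModel, det_fin_three, submatrix_apply, of_apply, id_eq, cons_val_zero,
    cons_val_one, cons_val]
  ring

theorem traceFreeMatrix_explicitModel (hβ : β ^ 2 = D.alpha ε p q r d)
    (hα : D.alpha ε p q r d ≠ 0) (l : D.Arc) :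
    traceFreeMatrix (explicitModel ε p q r d β l) =
      (matrixP β)⁻¹ * (matrixT β * traceFamily ε p q r d l) * matrixP β := by
  have hβ0 : β ≠ 0 := fun h => hα (by rw [← hβ, h, zero_pow two_ne_zero])
  rw [traceFamily, ← hβ, matrixP_inv_mul_matrixT_mul_matrixP hβ0]
  rfl

theorem sub_two_mul_sq (hd : d ^ 2 - D.cordMatrix ε p q * d + 1 = 0) :
    (D.cordMatrix ε p q - 2 * d) ^ 2 = D.cordMatrix ε p q ^ 2 - 4 := by
  linear_combination 4 * hd

section

variable (hpq : D.cordMatrix ε p q - 2 * d ≠ 0)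
include hpq

theorem aEntry_mul (l : D.Arc) : D.aEntry ε p q d l * (D.cordMatrix ε p q - 2 * d) =
    D.cordMatrix ε q l - D.cordMatrix ε p l * d :=
  div_mul_cancel₀ _ hpq

theorem aEntry_left : D.aEntry ε p q d p = 1 := by
  refine mul_right_cancel₀ hpq ?_
  rw [aEntry_mul hpq, cordMatrix_self, cordMatrix_comm ε q p, one_mul]

theorem aEntry_right (hd : d ^ 2 - D.cordMatrix ε p q * d + 1 = 0) : D.aEntry ε p q d q = d := by
  refine mul_right_cancel₀ hpq ?_
  rw [aEntry_mul hpq, cordMatrix_self]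
  linear_combination 2 * hd

theorem alpha_mul_sq (hd : d ^ 2 - D.cordMatrix ε p q * d + 1 = 0) :
    D.alpha ε p q r d * (D.cordMatrix ε p q ^ 2 - 4) = D.triple ε p q r - 2 := by
  rw [← sub_two_mul_sq hd, alpha, triple]
  linear_combination
    (D.aEntry ε p q d r * (D.cordMatrix ε p q - 2 * d) + D.cordMatrix ε q r
      - D.cordMatrix ε p r * d - D.cordMatrix ε p r * (D.cordMatrix ε p q - 2 * d)) *
        aEntry_mul hpq r + (4 - D.cordMatrix ε p r ^ 2) * hd

end

theorem alpha_mul_bEntry (hα : D.alpha ε p q r d ≠ 0) (l : D.Arc) :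
    D.alpha ε p q r d * bEntry ε p q r d l =
      D.cordMatrix ε r l / 2 + D.aEntry ε p q d r * D.aEntry ε p q d l -
        (D.aEntry ε p q d r * D.cordMatrix ε p l + D.aEntry ε p q d l * D.cordMatrix ε p r) / 2 :=
  mul_div_cancel₀ _ hα

variable (hpq : D.cordMatrix ε p q - 2 * d ≠ 0) (hα : D.alpha ε p q r d ≠ 0)
include hα

theorem bEntry_third : bEntry ε p q r d r = 1 := by
  refine mul_left_cancel₀ hα ?_
  rw [alpha_mul_bEntry hα, cordMatrix_self, alpha]
  ring

theorem explicitModel_dotProduct_third (hβ : β ^ 2 = D.alpha ε p q r d) (l : D.Arc) :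
    explicitModel ε p q r d β l ⬝ᵥ explicitModel ε p q r d β r = D.cordMatrix ε l r / 2 := by
  rw [explicitModel_dotProduct, bEntry_third hα, hβ, cordMatrix_comm ε l r]
  linear_combination alpha_mul_bEntry hα l

include hpq

theorem bEntry_left : bEntry ε p q r d p = 0 := by
  refine mul_left_cancel₀ hα ?_
  rw [alpha_mul_bEntry hα, aEntry_left hpq, cordMatrix_self, cordMatrix_comm ε r p]
  ring

theorem explicitModel_dotProduct_left (l : D.Arc) :
    explicitModel ε p q r d β l ⬝ᵥ explicitModel ε p q r d β p = D.cordMatrix ε l p / 2 := by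
  rw [explicitModel_dotProduct, bEntry_left hpq hα, aEntry_left hpq, cordMatrix_self,
    cordMatrix_comm ε l p]
  ring

variable (hd : d ^ 2 - D.cordMatrix ε p q * d + 1 = 0)
include hd

theorem bEntry_right : bEntry ε p q r d q = 0 := by
  refine mul_left_cancel₀ hα ?_
  rw [alpha_mul_bEntry hα, aEntry_right hpq hd, cordMatrix_comm ε r q]
  linear_combination -aEntry_mul hpq r / 2

theorem explicitModel_dotProduct_right (l : D.Arc) :
    explicitModel ε p q r d β l ⬝ᵥ explicitModel ε p q r d β q = D.cordMatrix ε l q / 2 := by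
  rw [explicitModel_dotProduct, bEntry_right hpq hα hd, aEntry_right hpq hd, cordMatrix_comm ε l q]
  linear_combination aEntry_mul hpq l / 2

theorem isVectorModel_explicitModel (hrank : D.augRank ε = 3) (hpqr : D.minor ε ![p, q, r] ≠ 0)
    (hβ : β ^ 2 = D.alpha ε p q r d) : IsVectorModel ε (explicitModel ε p q r d β) := by
  refine isVectorModel_of_submatrix_eq hrank hpqr (ext fun l i => ?_)
  change D.cordMatrix ε l (![p, q, r] i) =
    2 * (explicitModel ε p q r d β l ⬝ᵥ explicitModel ε p q r d β (![p, q, r] i))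
  rw [eq_comm, mul_comm, ← eq_div_iff two_ne_zero]
  fin_cases i
  exacts [explicitModel_dotProduct_left hpq hα l, explicitModel_dotProduct_right hpq hα hd l,
    explicitModel_dotProduct_third hα hβ l]

theorem isTraceFamily_traceFamily (hrank : D.augRank ε = 3) (hpqr : D.minor ε ![p, q, r] ≠ 0) :
    D.IsTraceFamily ε p q r d (traceFamily ε p q r d) := by
  intro l
  refine ⟨rfl, rfl, ?_, ?_⟩
  · change -(D.alpha ε p q r d * bEntry ε p q r d l) = _ - _ + bEntry ε p q r d l
      - bEntry ε p q r d l * _ * _ + _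
    have hb := alpha_mul_bEntry hα l
    rw [alpha] at hb ⊢
    linear_combination -2 * hb
  · obtain ⟨β, hβ⟩ := IsAlgClosed.exists_pow_nat_eq (D.alpha ε p q r d) two_pos
    have hone := (isVectorModel_explicitModel hpq hα hd hrank hpqr hβ).dotProduct_self l
    rw [explicitModel_dotProduct, hβ] at hone
    rw [traceFamily, det_fin_two_of]
    linear_combination hone

theorem exists_isOrientedModel_explicitModel (hrank : D.augRank ε = 3)
    (hpqr : D.minor ε ![p, q, r] ≠ 0) (hσ : σ ^ 2 = D.minor ε a / 2) :
    ∃ β, β ^ 2 = D.alpha ε p q r d ∧ IsOrientedModel ε a σ (explicitModel ε p q r d β) := by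
  obtain ⟨β, hβ⟩ := IsAlgClosed.exists_pow_nat_eq (D.alpha ε p q r d) two_pos
  have hmodel : ∀ β', β' ^ 2 = D.alpha ε p q r d → IsVectorModel ε (explicitModel ε p q r d β') :=
    fun β' => isVectorModel_explicitModel hpq hα hd hrank hpqr
  rcases (hmodel β hβ).two_mul_det_eq_or hσ with h | h
  · exact ⟨β, hβ, hmodel β hβ, h⟩
  · refine ⟨-β, (neg_sq β).trans hβ, hmodel _ ((neg_sq β).trans hβ), ?_⟩
    rw [det_submatrix_explicitModel_neg]
    linear_combination -h

end Explicit

section Elliptic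

variable {p q r : D.Arc} {d β : ℂ}

theorem IsGoodTriple.sub_two_mul_ne_zero (h : D.IsGoodTriple ε p q r)
    (hd : d ^ 2 - D.cordMatrix ε p q * d + 1 = 0) : D.cordMatrix ε p q - 2 * d ≠ 0 := by
  obtain ⟨⟨x, hx, hxe⟩, -⟩ := h
  intro h0
  have hsq := sub_two_mul_sq hd
  rw [h0, ← hxe] at hsq
  norm_cast at hsq
  nlinarith [hx.1, hx.2]

theorem IsGoodTriple.isSelfAdjoint_I_mul_sub (h : D.IsGoodTriple ε p q r)
    (hd : d ^ 2 - D.cordMatrix ε p q * d + 1 = 0) :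
    IsSelfAdjoint (Complex.I * (D.cordMatrix ε p q - 2 * d)) := by
  obtain ⟨⟨x, hx, hxe⟩, -⟩ := h
  refine isSelfAdjoint_of_sq_eq_ofReal (x := 4 - x ^ 2) (by nlinarith [hx.1, hx.2]) ?_
  rw [mul_pow, Complex.I_sq, sub_two_mul_sq hd, ← hxe]
  push_cast
  ring

theorem IsGoodTriple.exists_alpha_eq_ofReal (h : D.IsGoodTriple ε p q r)
    (hd : d ^ 2 - D.cordMatrix ε p q * d + 1 = 0) :
    ∃ α : ℝ, 0 < α ∧ D.alpha ε p q r d = α := by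
  have hα := alpha_mul_sq (r := r) (h.sub_two_mul_ne_zero hd) hd
  obtain ⟨⟨x, hx, hxe⟩, t, ht, hte⟩ := h
  have hx4 : 0 < 4 - x ^ 2 := by nlinarith [hx.1, hx.2]
  refine ⟨(2 - t) / (4 - x ^ 2), div_pos (sub_pos.2 ht) hx4, ?_⟩
  have hx4' : (4 : ℂ) - (x : ℂ) ^ 2 ≠ 0 := by exact_mod_cast hx4.ne'
  push_cast
  rw [eq_div_iff hx4', hxe, hte]
  linear_combination -hα

theorem IsElliptic.isSelfAdjoint_I_mul_aEntry_sub (h : D.IsElliptic ε)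
    (hpqr : D.IsGoodTriple ε p q r) (hd : d ^ 2 - D.cordMatrix ε p q * d + 1 = 0) (l : D.Arc) :
    IsSelfAdjoint (Complex.I * (D.aEntry ε p q d l - D.cordMatrix ε p l / 2)) := by
  have hpq := hpqr.sub_two_mul_ne_zero hd
  have hquot : Complex.I * (D.aEntry ε p q d l - D.cordMatrix ε p l / 2) =
      (D.cordMatrix ε p l * D.cordMatrix ε p q / 2 - D.cordMatrix ε q l) /
        (Complex.I * (D.cordMatrix ε p q - 2 * d)) := by
    rw [eq_div_iff (mul_ne_zero Complex.I_ne_zero hpq)]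
    linear_combination Complex.I ^ 2 * aEntry_mul hpq l +
      (D.cordMatrix ε q l - D.cordMatrix ε p l * D.cordMatrix ε p q / 2) * Complex.I_sq
  have hreal := h.isSelfAdjoint_cordMatrix
  rw [hquot]
  exact ((((hreal p l).mul (hreal p q)).div (.ofNat 2)).sub (hreal q l)).div
    (hpqr.isSelfAdjoint_I_mul_sub hd)

theorem IsElliptic.isSelfAdjoint_bEntry (h : D.IsElliptic ε) (hpqr : D.IsGoodTriple ε p q r)
    (hd : d ^ 2 - D.cordMatrix ε p q * d + 1 = 0) (l : D.Arc) :
    IsSelfAdjoint (bEntry ε p q r d l) := by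
  have hbEntry : bEntry ε p q r d l =
      (D.cordMatrix ε r l / 2 -
        Complex.I * (D.aEntry ε p q d r - D.cordMatrix ε p r / 2) *
          (Complex.I * (D.aEntry ε p q d l - D.cordMatrix ε p l / 2)) -
        D.cordMatrix ε p r * D.cordMatrix ε p l / 4) / D.alpha ε p q r d := by
    rw [bEntry]
    congr 1
    linear_combination (D.aEntry ε p q d r - D.cordMatrix ε p r / 2) *
      (D.aEntry ε p q d l - D.cordMatrix ε p l / 2) * Complex.I_sq
  have hreal := h.isSelfAdjoint_cordMatrix
  have hv := h.isSelfAdjoint_I_mul_aEntry_sub hpqr hd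
  have hα : IsSelfAdjoint (D.alpha ε p q r d) := by
    obtain ⟨α, -, hα⟩ := hpqr.exists_alpha_eq_ofReal hd
    exact hα ▸ Complex.conj_ofReal α
  rw [hbEntry]
  exact ((((hreal r l).div (.ofNat 2)).sub ((hv r).mul (hv l))).sub
    (((hreal p r).mul (hreal p l)).div (.ofNat 4))).div hα

theorem IsElliptic.isSelfAdjoint_explicitModel (h : D.IsElliptic ε) (hpqr : D.IsGoodTriple ε p q r)
    (hd : d ^ 2 - D.cordMatrix ε p q * d + 1 = 0) (hβ : β ^ 2 = D.alpha ε p q r d) (l : D.Arc) :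
    IsSelfAdjoint (explicitModel ε p q r d β l) := by
  obtain ⟨α, hαpos, hα⟩ := hpqr.exists_alpha_eq_ofReal hd
  have hβreal : IsSelfAdjoint β := isSelfAdjoint_of_sq_eq_ofReal hαpos.le (hβ.trans hα)
  ext i
  fin_cases i
  · exact (h.isSelfAdjoint_cordMatrix p l).div (.ofNat 2)
  · exact h.isSelfAdjoint_I_mul_aEntry_sub hpqr hd l
  · exact (hβreal.mul (h.isSelfAdjoint_bEntry hpqr hd l)).neg

theorem IsFrakX.exists_explicit_hom (hχ : D.IsFrakX ε a σ χ) (hε : ε ∈ D.augVariety)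
    (hrank : D.augRank ε = 3) (ha : D.minor ε a ≠ 0) (hσ : σ ^ 2 = D.minor ε a / 2)
    (hell : D.IsElliptic ε) (hpqr : D.IsGoodTriple ε p q r)
    (hd : d ^ 2 - D.cordMatrix ε p q * d + 1 = 0) :
    ∃ (A : D.Arc → Matrix (Fin 2) (Fin 2) ℂ) (β : ℂ)
      (ρ : D.KnotGroup →* specialUnitaryGroup (Fin 2) ℂ),
      D.IsTraceFamily ε p q r d A ∧ β ^ 2 = D.alpha ε p q r d ∧
      (∀ l, (ρ (D.meridian l) : Matrix (Fin 2) (Fin 2) ℂ) =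
        (matrixP β)⁻¹ * (matrixT β * A l) * matrixP β) ∧
      D.IsCharacterOf χ ρ := by
  have hpq := hpqr.sub_two_mul_ne_zero hd
  have hα : D.alpha ε p q r d ≠ 0 := by
    obtain ⟨α, hαpos, hα⟩ := hpqr.exists_alpha_eq_ofReal hd
    exact hα ▸ Complex.ofReal_ne_zero.2 hαpos.ne'
  obtain ⟨β, hβ, hU⟩ :=
    exists_isOrientedModel_explicitModel hpq hα hd hrank hpqr.minor_ne_zero hσ
  have hmem : ∀ l, traceFreeMatrix (explicitModel ε p q r d β l) ∈
      specialUnitaryGroup (Fin 2) ℂ := fun l =>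
    traceFreeMatrix_mem_specialUnitaryGroup_iff.2
      ⟨hU.isVectorModel.dotProduct_self l, hell.isSelfAdjoint_explicitModel hpqr hd hβ l⟩
  obtain ⟨ρ, hρ⟩ := hU.isVectorModel.exists_hom hε ha
    (j := (specialUnitaryGroup (Fin 2) ℂ).subtype) Subtype.val_injective
    (g := fun l => ⟨_, hmem l⟩) fun l => rfl
  have hρU : ∀ l, (ρ (D.meridian l) : Matrix (Fin 2) (Fin 2) ℂ) =
      traceFreeMatrix (explicitModel ε p q r d β l) := fun l => congrArg Subtype.val (hρ l)
  exact ⟨traceFamily ε p q r d, β, ρ,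
    isTraceFamily_traceFamily hpq hα hd hrank hpqr.minor_ne_zero, hβ,
    fun l => (hρU l).trans (traceFreeMatrix_explicitModel hβ hα l),
    hχ.eq_trace ha hU (ψ := (specialUnitaryGroup (Fin 2) ℂ).subtype.comp ρ) hρU⟩

theorem IsFrakX.isElliptic_iff_isSU2Character (hχ : D.IsFrakX ε a σ χ) (hε : ε ∈ D.augVariety)
    (hrank : D.augRank ε = 3) (ha : D.minor ε a ≠ 0) (hσ : σ ^ 2 = D.minor ε a / 2) :
    D.IsElliptic ε ↔ D.IsSU2Character χ := by
  constructor
  · intro hell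
    obtain ⟨d, hd⟩ : ∃ d : ℂ, d ^ 2 - D.cordMatrix ε (a 0) (a 1) * d + 1 = 0 := by
      obtain ⟨s, hs⟩ := IsAlgClosed.exists_pow_nat_eq (D.cordMatrix ε (a 0) (a 1) ^ 2 - 4) two_pos
      exact ⟨(D.cordMatrix ε (a 0) (a 1) + s) / 2, by linear_combination hs / 4⟩
    obtain ⟨-, -, ρ, -, -, -, hρ⟩ :=
      hχ.exists_explicit_hom hε hrank ha hσ hell (hell.isGoodTriple ha) hd
    exact ⟨ρ, hρ⟩
  · rintro ⟨ρ, hρ⟩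
    obtain ⟨U, hU, hreal, -⟩ := hχ.exists_isSelfAdjoint_model hρ
    exact hU.isElliptic_of_isSelfAdjoint hreal

end Elliptic

end

end KnotDiagram

end

theorem mainTheorem3 (D : KnotDiagram) (ε : D.PairCoords) (hε : ε ∈ D.augVariety)
    (hrank : D.augRank ε = 3) :
    -- the choices on which the trace-free character `𝔛(ε)` depends can be made
    (∃ a : Fin 3 → D.Arc, D.minor ε a ≠ 0) ∧
    -- for all such choices, `𝔛(ε)` exists and is unique ...
    ∀ (a : Fin 3 → D.Arc) (σ : ℂ), D.minor ε a ≠ 0 → σ ^ 2 = D.minor ε a / 2 →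
      ∃ χ : D.KnotGroup → ℂ, D.IsFrakX ε a σ χ ∧ (∀ χ', D.IsFrakX ε a σ χ' → χ' = χ) ∧
        -- ... it is not binary-dihedral, and it is an `SU(2)` character iff `ε` is elliptic
        ¬ D.IsBinaryDihedralCharacter χ ∧
        (D.IsElliptic ε ↔ D.IsSU2Character χ) ∧
        -- the `SU(2)` representation is the explicit conjugate `m_l ↦ P⁻¹ (T A_l) P`
        (D.IsElliptic ε →
          (∃ p q r : D.Arc, D.IsGoodTriple ε p q r) ∧
          ∀ (p q r : D.Arc) (d : ℂ), D.IsGoodTriple ε p q r →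
            d ^ 2 - D.cordMatrix ε p q * d + 1 = 0 →
            ∃ (A : D.Arc → Matrix (Fin 2) (Fin 2) ℂ) (β : ℂ)
              (ρ : D.KnotGroup →* Matrix.specialUnitaryGroup (Fin 2) ℂ),
              D.IsTraceFamily ε p q r d A ∧ β ^ 2 = D.alpha ε p q r d ∧
              (∀ l, (ρ (D.meridian l) : Matrix (Fin 2) (Fin 2) ℂ) =
                (matrixP β)⁻¹ * (matrixT β * A l) * matrixP β) ∧
              D.IsCharacterOf χ ρ) := by
  refine ⟨exists_det_submatrix_ne_zero_of_isSymm (KnotDiagram.cordMatrix_isSymm ε) hrank,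
    fun a σ ha hσ => ?_⟩
  obtain ⟨χ, hχ⟩ := KnotDiagram.exists_isFrakX hε hrank ha hσ
  refine ⟨χ, hχ, fun χ' hχ' => hχ.unique hχ' ha, hχ.not_isBinaryDihedralCharacter hε ha,
    hχ.isElliptic_iff_isSU2Character hε hrank ha hσ, fun hell => ⟨?_, fun p q r d hpqr hd => ?_⟩⟩
  · exact ⟨a 0, a 1, a 2, hell.isGoodTriple ha⟩
  · exact hχ.exists_explicit_hom hε hrank ha hσ hell hpqr hd
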